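/- Let $\mathbb{D}=\{z\in\mathbb{C}:|z|<1\}$. For functions $F,G$ analytic in $\mathbb{D}$ write $F\prec G$ if there is an analytic $\omega:\mathbb{D}\to\mathbb{D}$ with $\omega(0)=0$ and $F=G\circ\omega$. For $t\in(1/2,1)$ let $\mathcal{B}_\sigma(t)$ be the class of functions $f(z)=z+\sum_{n\ge2}a_nz^n$, analytic and univalent in $\mathbb{D}$, whose inverse (defined near $0$) continues analytically to a univalent function $g=f^{-1}$ on $\mathbb{D}$, and for which $$f'(z)\prec\frac1{1-2tz+z^2}\quad\text{and}\quad g'(w)\prec\frac1{1-2tw+w^2}\qquad(z,w\in\mathbb{D}).$$ For $\lambda\ge 1$, $\mu\ge 0$ put $$\begin{aligned}M_1(\lambda,\mu;t)={}&16t^2\left|3(2t^2-1)(\lambda+\mu)^3-(\mu^2+3\mu+2)(3\lambda+\mu)t^2\right|(2\lambda+\mu)^2\\&-24t\left[t^2(3\lambda+\mu)+(4t^2-1)(\lambda+\mu)(2\lambda+\mu)\right](\lambda+\mu)^2(2\lambda+\mu)-24t^2\lambda^2(\lambda+\mu)^3.\end{aligned}$$ Then $M_1(1,1;t)=0$ has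 exactly one root $t_0$ in $(1/2,1)$, with $|t_0-0.603615|<10^{-6}$, and every $f\in\mathcal{B}_\sigma(t)$ satisfies $$|a_2a_4-a_3^2|\le\begin{cases}t^2(1-t^2), & \frac12<t\le t_0,\\[1ex]\dfrac{t\,(260t^4+84t^3-139t^2-18t+9)}{8\,(18t^3+42t^2-17t-9)}, & t_0<t<1.\end{cases}$$ -/

import Mathlib

open Set Filter Topology

/-- The open unit disk. -/
def unitDisk : Set ℂ := Metric.ball 0 1

/-- The `n`-th Taylor coefficient of `f` at the origin, `f z = ∑ a_n z ^ n`. -/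
noncomputable def taylorCoeff (f : ℂ → ℂ) (n : ℕ) : ℂ := iteratedDeriv n f 0 / (n.factorial : ℂ)

/-- The class `𝒜`: analytic in the unit disk, `f 0 = 0`, `f' 0 = 1`
(only the values of `f` in the unit disk matter). -/
def classA : Set (ℂ → ℂ) :=
  {f | DifferentiableOn ℂ f unitDisk ∧ f 0 = 0 ∧ deriv f 0 = 1}

/-- The class `𝒮`: univalent functions in `𝒜`. -/
def classS : Set (ℂ → ℂ) := {f | f ∈ classA ∧ InjOn f unitDisk}

/-- `g` is the analytic continuation to the unit disk of the inverse of `f`: it is analytic in the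
disk and inverts `f` near the origin (this determines `g` on the disk by the identity theorem). -/
def IsInverseOnDisk (f g : ℂ → ℂ) : Prop :=
  DifferentiableOn ℂ g unitDisk ∧ ∀ᶠ z in 𝓝 (0 : ℂ), g (f z) = z

/-- The class `σ` of bi-univalent functions: `f` and `f⁻¹` are both univalent in the unit disk. -/
def biUnivalent : Set (ℂ → ℂ) :=
  {f | f ∈ classS ∧ ∃ g, IsInverseOnDisk f g ∧ InjOn g unitDisk}

/-- Subordination `F ≺ G` in the unit disk, through a Schwarz function `w`. -/
def Subordinate (F G : ℂ → ℂ) : Prop :=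
  ∃ w : ℂ → ℂ, DifferentiableOn ℂ w unitDisk ∧ w 0 = 0 ∧ (∀ z ∈ unitDisk, ‖w z‖ < 1) ∧
    ∀ z ∈ unitDisk, F z = G (w z)

/-- `H(z, t) = 1 / (1 - 2 t z + z²)`, the generating function of the Chebyshev polynomials of the
second kind. For `-1 < t ≤ 1` the denominator has no zero in the unit disk. -/
noncomputable def chebyshevH (t : ℝ) (z : ℂ) : ℂ := 1 / (1 - 2 * (t : ℂ) * z + z ^ 2)

/-- The class `ℬ_σ(t)`: bi-univalent `f` with `f' ≺ H(·, t)` and `(f⁻¹)' ≺ H(·, t)`. -/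
def classBSigma (t : ℝ) : Set (ℂ → ℂ) :=
  {f | f ∈ biUnivalent ∧ Subordinate (deriv f) (chebyshevH t) ∧
    ∃ g, IsInverseOnDisk f g ∧ Subordinate (deriv g) (chebyshevH t)}

/-- The quantity `M₁(λ, μ; t)`, whose zero for `λ = μ = 1` is the threshold `t₀`. -/
noncomputable def M₁ (l m t : ℝ) : ℝ :=
  16 * t ^ 2 * |3 * (2 * t ^ 2 - 1) * (l + m) ^ 3 - (m ^ 2 + 3 * m + 2) * (3 * l + m) * t ^ 2|
      * (2 * l + m) ^ 2
    - 24 * t * (t ^ 2 * (3 * l + m) + (4 * t ^ 2 - 1) * (l + m) * (2 * l + m))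
      * (l + m) ^ 2 * (2 * l + m)
    - 24 * t ^ 2 * l ^ 2 * (l + m) ^ 3

/-!
Write `f'(z) = H(w(z), t)` and `g'(ζ) = H(v(ζ), t)` with Schwarz functions `w = c₁ z + c₂ z² + …` and
`v = d₁ ζ + d₂ ζ² + …`. Since `g'(f(z)) f'(z) = 1`, both subordinations become polynomial relations
in the `z`-plane, `f' (1 - 2 t w + w²) = 1` and `f' = 1 - 2 t v(f) + v(f)²`, so the Taylor
coefficients of `g` itself never enter. Comparing coefficients up to `z³` gives `d₁ = -c₁` and
expresses `a₂ a₄ - a₃²` through the `cᵢ` and `dᵢ` (`hankel_eq`).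

The Schur algorithm (`schur_step`, `schwarz_coeff`) parametrizes the coefficients of a Schwarz
function: `c₂ = (1 - |c₁|²) x` and `c₃ = (1 - |c₁|²) (p - c̄₁ x²)` with `|x| ≤ 1` and
`|p| ≤ 1 - |x|²`. The triangle inequality then gives a majorant which is largest
at `|x| = |y| = 1` (`hankel_majorant_le`), where it is the quadratic polynomial
`A u² + B u (1 - u) + C (1 - u)²` in `u = |c₁|²`, with `A = t² (1 - t²)`,
`B = 7 t³ / 3 + t² / 2 - t / 2` and `C = 4 t² / 9`.

The leading coefficient of this polynomial in `u` is `-(t / 18) P(t)`, where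
`P(t) = 18 t³ + 42 t² - 17 t - 9`, and `M₁(1, 1; t) = -192 t P(t)`. Hence the threshold `t₀` is the
root of `P`, which is increasing on `(1 / 2, ∞)`. For `t ≤ t₀` the polynomial is convex and its maximum on
`[0, 1]` is its value `A` at `u = 1`; for `t > t₀` it is concave and bounded by its value at the
vertex, which is the second bound.
-/

/-! ### Third-order expansions at the origin -/

open Asymptotics in
/-- `HasCubicJet f a₀ a₁ a₂ a₃` says that `f z = a₀ + a₁ z + a₂ z² + a₃ z³ + O(z⁴)` at the origin. -/
def HasCubicJet (f : ℂ → ℂ) (a₀ a₁ a₂ a₃ : ℂ) : Prop :=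
  (fun z => f z - (a₀ + a₁ * z + a₂ * z ^ 2 + a₃ * z ^ 3)) =O[𝓝 0] fun z : ℂ => z ^ 4

namespace HasCubicJet

open Asymptotics

variable {f g : ℂ → ℂ} {a₀ a₁ a₂ a₃ b₀ b₁ b₂ b₃ : ℂ}

theorem congr (hf : HasCubicJet f a₀ a₁ a₂ a₃) (h : f =ᶠ[𝓝 0] g) :
    HasCubicJet g a₀ a₁ a₂ a₃ := by
  refine IsBigO.congr' hf ?_ EventuallyEq.rfl
  filter_upwards [h] with z hz
  rw [hz]

theorem const (a : ℂ) : HasCubicJet (fun _ => a) a 0 0 0 := by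
  refine (isBigO_zero _ _).congr_left fun z => ?_
  simp

theorem id : HasCubicJet (fun z => z) 0 1 0 0 := by
  refine (isBigO_zero _ _).congr_left fun z => ?_
  simp

theorem add (hf : HasCubicJet f a₀ a₁ a₂ a₃) (hg : HasCubicJet g b₀ b₁ b₂ b₃) :
    HasCubicJet (fun z => f z + g z) (a₀ + b₀) (a₁ + b₁) (a₂ + b₂) (a₃ + b₃) := by
  refine (IsBigO.add hf hg).congr_left fun z => ?_
  ring

theorem isBigO_one (hf : HasCubicJet f a₀ a₁ a₂ a₃) : f =O[𝓝 0] fun _ => (1 : ℂ) := by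
  have h4 : (fun z : ℂ => z ^ 4) =O[𝓝 0] fun _ => (1 : ℂ) :=
    (continuous_pow 4).continuousAt.tendsto.isBigO_one ℂ
  have hp : (fun z : ℂ => a₀ + a₁ * z + a₂ * z ^ 2 + a₃ * z ^ 3) =O[𝓝 0] fun _ => (1 : ℂ) :=
    (Continuous.continuousAt (by fun_prop)).tendsto.isBigO_one ℂ
  exact ((IsBigO.trans hf h4).add hp).congr_left fun z => by ring

theorem mul (hf : HasCubicJet f a₀ a₁ a₂ a₃) (hg : HasCubicJet g b₀ b₁ b₂ b₃) :
    HasCubicJet (fun z => f z * g z) (a₀ * b₀) (a₀ * b₁ + a₁ * b₀)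
      (a₀ * b₂ + a₁ * b₁ + a₂ * b₀) (a₀ * b₃ + a₁ * b₂ + a₂ * b₁ + a₃ * b₀) := by
  have h1 := hf.isBigO_one.mul hg
  have hq : (fun z : ℂ => b₀ + b₁ * z + b₂ * z ^ 2 + b₃ * z ^ 3) =O[𝓝 0] fun _ => (1 : ℂ) :=
    (Continuous.continuousAt (by fun_prop)).tendsto.isBigO_one ℂ
  have h2 := IsBigO.mul hf hq
  have hr : (fun z : ℂ => (a₁ * b₃ + a₂ * b₂ + a₃ * b₁) + (a₂ * b₃ + a₃ * b₂) * z
      + a₃ * b₃ * z ^ 2) =O[𝓝 0] fun _ => (1 : ℂ) :=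
    (Continuous.continuousAt (by fun_prop)).tendsto.isBigO_one ℂ
  have h3 := (isBigO_refl (fun z : ℂ => z ^ 4) (𝓝 0)).mul hr
  simp only [one_mul, mul_one] at h1 h2 h3
  exact ((h1.add h2).add h3).congr_left fun z => by ring

theorem const_mul (hf : HasCubicJet f a₀ a₁ a₂ a₃) (c : ℂ) :
    HasCubicJet (fun z => c * f z) (c * a₀) (c * a₁) (c * a₂) (c * a₃) := by
  simpa using (const c).mul hf

theorem sub (hf : HasCubicJet f a₀ a₁ a₂ a₃) (hg : HasCubicJet g b₀ b₁ b₂ b₃) :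
    HasCubicJet (fun z => f z - g z) (a₀ - b₀) (a₁ - b₁) (a₂ - b₂) (a₃ - b₃) := by
  refine (IsBigO.sub hf hg).congr_left fun z => ?_
  ring

theorem tendsto (hf : HasCubicJet f a₀ a₁ a₂ a₃) : Tendsto f (𝓝 0) (𝓝 a₀) := by
  have h4 : Tendsto (fun z : ℂ => z ^ 4) (𝓝 0) (𝓝 0) := by
    simpa using ((continuous_pow 4).tendsto (0 : ℂ))
  have hp : Tendsto (fun z : ℂ => a₀ + a₁ * z + a₂ * z ^ 2 + a₃ * z ^ 3) (𝓝 0) (𝓝 a₀) := by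
    have : Continuous fun z : ℂ => a₀ + a₁ * z + a₂ * z ^ 2 + a₃ * z ^ 3 := by fun_prop
    simpa using this.tendsto 0
  simpa using (IsBigO.trans_tendsto hf h4).add hp

/-- Composition with an inner function fixing the origin. -/
theorem comp (hg : HasCubicJet g b₀ b₁ b₂ b₃) (hf : HasCubicJet f 0 a₁ a₂ a₃) :
    HasCubicJet (fun z => g (f z)) b₀ (b₁ * a₁) (b₁ * a₂ + b₂ * a₁ ^ 2)
      (b₁ * a₃ + 2 * b₂ * a₁ * a₂ + b₃ * a₁ ^ 3) := by
  have hfz : f =O[𝓝 0] fun z : ℂ => z := by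
    have hp : (fun z : ℂ => a₁ + a₂ * z + a₃ * z ^ 2) =O[𝓝 0] fun _ => (1 : ℂ) :=
      (Continuous.continuousAt (by fun_prop)).tendsto.isBigO_one ℂ
    have h3 : (fun z : ℂ => z ^ 3) =O[𝓝 0] fun _ => (1 : ℂ) :=
      (Continuous.continuousAt (by fun_prop)).tendsto.isBigO_one ℂ
    have hz := isBigO_refl (fun z : ℂ => z) (𝓝 0)
    have h4 : (fun z : ℂ => z ^ 4) =O[𝓝 0] fun z : ℂ => z :=
      (hz.mul h3).congr (fun z => by ring) fun z => by ring
    have h5 := (hz.mul hp).congr_right (g₂ := fun z : ℂ => z) fun z => by ring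
    exact ((IsBigO.trans hf h4).add h5).congr_left fun z => by ring
  have hrem := (IsBigO.comp_tendsto hg hf.tendsto).trans (hfz.pow 4)
  have hsq := hf.mul hf
  have hpoly := (((const b₀).add (hf.const_mul b₁)).add (hsq.const_mul b₂)).add
    ((hsq.mul hf).const_mul b₃)
  refine (hrem.add hpoly).congr_left fun z => ?_
  simp only [Function.comp_apply]
  ring

/-- Peels off one coefficient: if `a + z q(z) = O(zⁿ⁺¹)`, then `a = 0` and `q(z) = O(zⁿ)`. -/
theorem eq_zero_of_add_mul {q : ℂ → ℂ} {a : ℂ} {n : ℕ} (hq : Continuous q)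
    (h : (fun z => a + z * q z) =O[𝓝[≠] 0] fun z : ℂ => z ^ (n + 1)) :
    a = 0 ∧ q =O[𝓝[≠] 0] fun z : ℂ => z ^ n := by
  have ha : a = 0 := by
    have h0 : Tendsto (fun z : ℂ => z ^ (n + 1)) (𝓝[≠] 0) (𝓝 0) := by
      have := (continuous_pow (n + 1)).tendsto (0 : ℂ)
      simp only [ne_eq, Nat.add_eq_zero_iff, one_ne_zero, and_false, not_false_eq_true,
        zero_pow] at this
      exact this.mono_left nhdsWithin_le_nhds
    have h1 : Tendsto (fun z : ℂ => a + z * q z) (𝓝[≠] 0) (𝓝 a) := by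
      have : Continuous fun z : ℂ => a + z * q z := by fun_prop
      simpa using (this.tendsto 0).mono_left nhdsWithin_le_nhds
    exact tendsto_nhds_unique h1 (h.trans_tendsto h0)
  refine ⟨ha, ?_⟩
  subst ha
  have h2 := (isBigO_refl (fun z : ℂ => z⁻¹) (𝓝[≠] 0)).mul h
  refine h2.congr' ?_ ?_ <;> filter_upwards [self_mem_nhdsWithin] with z hz
  · have : z ≠ 0 := hz
    field_simp
    ring
  · have : z ≠ 0 := hz
    rw [pow_succ]
    field_simp

theorem unique (hf : HasCubicJet f a₀ a₁ a₂ a₃) (hg : HasCubicJet f b₀ b₁ b₂ b₃) :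
    a₀ = b₀ ∧ a₁ = b₁ ∧ a₂ = b₂ ∧ a₃ = b₃ := by
  have h : (fun z => (a₀ - b₀) + z * ((a₁ - b₁) + z * ((a₂ - b₂) + z * ((a₃ - b₃) + z * 0))))
      =O[𝓝[≠] 0] fun z : ℂ => z ^ 4 :=
    ((IsBigO.sub hg hf).mono nhdsWithin_le_nhds).congr_left fun z => by ring
  obtain ⟨h0, h⟩ := eq_zero_of_add_mul (by fun_prop) h
  obtain ⟨h1, h⟩ := eq_zero_of_add_mul (by fun_prop) h
  obtain ⟨h2, h⟩ := eq_zero_of_add_mul (by fun_prop) h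
  obtain ⟨h3, -⟩ := eq_zero_of_add_mul (by fun_prop) h
  exact ⟨sub_eq_zero.1 h0, sub_eq_zero.1 h1, sub_eq_zero.1 h2, sub_eq_zero.1 h3⟩

end HasCubicJet

/-- The Taylor expansion of an analytic function, truncated after the cubic term. -/
theorem AnalyticAt.hasCubicJet {f : ℂ → ℂ} (hf : AnalyticAt ℂ f 0) :
    HasCubicJet f (taylorCoeff f 0) (taylorCoeff f 1) (taylorCoeff f 2) (taylorCoeff f 3) := by
  have h := hf.hasFPowerSeriesAt.isBigO_sub_partialSum_pow 4
  have h' : (fun y : ℂ => ‖y‖ ^ 4) =O[𝓝 0] fun y : ℂ => y ^ 4 :=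
    Asymptotics.isBigO_of_le _ fun z => by simp
  refine (h.trans h').congr_left fun z => ?_
  simp [FormalMultilinearSeries.partialSum, Finset.sum_range_succ, taylorCoeff,
    FormalMultilinearSeries.ofScalars, mul_comm]

theorem taylorCoeff_deriv (f : ℂ → ℂ) (n : ℕ) :
    taylorCoeff (deriv f) n = (n + 1) * taylorCoeff f (n + 1) := by
  have h1 : ((n : ℂ) + 1) ≠ 0 := by exact_mod_cast n.succ_ne_zero
  have h2 : (n.factorial : ℂ) ≠ 0 := by exact_mod_cast n.factorial_ne_zero
  simp only [taylorCoeff, iteratedDeriv_succ', Nat.factorial_succ]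
  push_cast
  field_simp

/-! ### Coefficients of Schwarz functions -/

/-- The disk automorphism `u ↦ (u - b) / (1 - b̄ u)` is bounded by one on the disk, in a form without
division. -/
theorem norm_sub_le_norm_one_sub_conj_mul {u b : ℂ} (hu : ‖u‖ ≤ 1) (hb : ‖b‖ ≤ 1) :
    ‖u - b‖ ≤ ‖1 - (starRingEnd ℂ) b * u‖ := by
  refine le_of_sq_le_sq ?_ (norm_nonneg _)
  have h1 : ‖1 - (starRingEnd ℂ) b * u‖ ^ 2 - ‖u - b‖ ^ 2 = (1 - ‖u‖ ^ 2) * (1 - ‖b‖ ^ 2) := by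
    simp only [← Complex.normSq_eq_norm_sq, Complex.normSq_apply, Complex.sub_re, Complex.sub_im,
      Complex.mul_re, Complex.mul_im, Complex.conj_re, Complex.conj_im, Complex.one_re,
      Complex.one_im]
    ring
  have h2 : 0 ≤ (1 - ‖u‖ ^ 2) * (1 - ‖b‖ ^ 2) :=
    mul_nonneg (by nlinarith [norm_nonneg u]) (by nlinarith [norm_nonneg b])
  linarith

/-- A function bounded by one on the disk and vanishing at the origin is `z` times a function
bounded by one. -/
theorem exists_eq_mul_of_norm_le_one {B : ℂ → ℂ} (hB : DifferentiableOn ℂ B unitDisk)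
    (h0 : B 0 = 0) (h1 : ∀ z ∈ unitDisk, ‖B z‖ ≤ 1) :
    ∃ χ : ℂ → ℂ, DifferentiableOn ℂ χ unitDisk ∧ (∀ z ∈ unitDisk, ‖χ z‖ ≤ 1) ∧
      ∀ z, B z = z * χ z := by
  refine ⟨dslope B 0, (Complex.differentiableOn_dslope (Metric.ball_mem_nhds 0 one_pos)).2 hB,
    fun z hz => ?_, fun z => ?_⟩
  · have := Complex.norm_dslope_le_div_of_mapsTo_ball (R₂ := 1) hB
      (fun w hw => by simpa [h0] using h1 w hw) hz
    simpa using this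
  · have := sub_smul_dslope B 0 z
    simpa [h0] using this.symm

/-- One step of the Schur algorithm. If `|φ(0)| = 1`, then `φ` is constant and `χ = 0` works, so this
case needs no separate treatment later. -/
theorem schur_step {φ : ℂ → ℂ} (hφ : DifferentiableOn ℂ φ unitDisk)
    (h1 : ∀ z ∈ unitDisk, ‖φ z‖ ≤ 1) :
    ∃ χ : ℂ → ℂ, DifferentiableOn ℂ χ unitDisk ∧ (∀ z ∈ unitDisk, ‖χ z‖ ≤ 1) ∧
      ∀ z ∈ unitDisk, φ z - φ 0 = z * χ z * (1 - (starRingEnd ℂ) (φ 0) * φ z) := by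
  have hmem : (0 : ℂ) ∈ unitDisk := Metric.mem_ball_self one_pos
  rcases (h1 0 hmem).eq_or_lt with h | h
  · refine ⟨fun _ => 0, differentiableOn_const _, by simp, fun z hz => ?_⟩
    have hc := Complex.eqOn_of_isPreconnected_of_isMaxOn_norm (convex_ball 0 1).isPreconnected
      Metric.isOpen_ball hφ hmem (fun w hw => by simpa [h] using h1 w hw) hz
    simp only [Function.const] at hc
    simp [hc]
  · have hne : ∀ z ∈ unitDisk, 1 - (starRingEnd ℂ) (φ 0) * φ z ≠ 0 := fun z hz h' => by
      have h2 : ‖(starRingEnd ℂ) (φ 0) * φ z‖ < 1 := by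
        rw [norm_mul, RCLike.norm_conj]
        nlinarith [h1 z hz, norm_nonneg (φ 0), norm_nonneg (φ z)]
      rw [← sub_eq_zero.1 h'] at h2
      simp at h2
    obtain ⟨χ, hχ, hχ1, hχz⟩ := exists_eq_mul_of_norm_le_one
      (B := fun z => (φ z - φ 0) / (1 - (starRingEnd ℂ) (φ 0) * φ z))
      ((hφ.sub_const _).div ((hφ.const_mul _).const_sub _) hne) (by simp)
      (fun z hz => by
        rw [norm_div]
        exact div_le_one_of_le₀ (norm_sub_le_norm_one_sub_conj_mul (h1 z hz) h.le)
          (norm_nonneg _))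
    refine ⟨χ, hχ, hχ1, fun z hz => ?_⟩
    rw [← hχz z, div_mul_cancel₀ _ (hne z hz)]

theorem unitDisk_mem_nhds_zero : unitDisk ∈ 𝓝 (0 : ℂ) := Metric.ball_mem_nhds 0 one_pos

theorem DifferentiableOn.analyticAt_zero {f : ℂ → ℂ} (hf : DifferentiableOn ℂ f unitDisk) :
    AnalyticAt ℂ f 0 :=
  hf.analyticAt unitDisk_mem_nhds_zero

/-- The Schur step on the level of coefficients. -/
theorem schur_step_jet {φ : ℂ → ℂ} {b₀ b₁ b₂ b₃ : ℂ} (hφ : DifferentiableOn ℂ φ unitDisk)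
    (h1 : ∀ z ∈ unitDisk, ‖φ z‖ ≤ 1) (hj : HasCubicJet φ b₀ b₁ b₂ b₃) :
    ‖b₀‖ ≤ 1 ∧ ∃ (χ : ℂ → ℂ) (p₀ p₁ p₂ p₃ : ℂ), DifferentiableOn ℂ χ unitDisk ∧
      (∀ z ∈ unitDisk, ‖χ z‖ ≤ 1) ∧ HasCubicJet χ p₀ p₁ p₂ p₃ ∧
      b₁ = (1 - (‖b₀‖ : ℂ) ^ 2) * p₀ ∧
      b₂ = (1 - (‖b₀‖ : ℂ) ^ 2) * p₁ - (starRingEnd ℂ) b₀ * p₀ * b₁ := by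
  obtain ⟨χ, hχ, hχ1, hχz⟩ := schur_step hφ h1
  have hb : φ 0 = b₀ :=
    tendsto_nhds_unique hφ.analyticAt_zero.continuousAt.tendsto hj.tendsto
  rw [hb] at hχz
  have hχj := hχ.analyticAt_zero.hasCubicJet
  refine ⟨hb ▸ h1 0 (mem_of_mem_nhds unitDisk_mem_nhds_zero), χ, _, _, _, _, hχ, hχ1, hχj, ?_⟩
  have hl := hj.sub (HasCubicJet.const b₀)
  have hr := (HasCubicJet.id.mul hχj).mul
    ((HasCubicJet.const 1).sub (hj.const_mul ((starRingEnd ℂ) b₀)))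
  have hl' := hl.congr (mem_of_superset unitDisk_mem_nhds_zero hχz)
  obtain ⟨-, e1, e2, -⟩ := hl'.unique hr
  have hn : (starRingEnd ℂ) b₀ * b₀ = (‖b₀‖ : ℂ) ^ 2 := Complex.conj_mul' b₀
  constructor
  · linear_combination e1 - taylorCoeff χ 0 * hn
  · linear_combination e2 - taylorCoeff χ 1 * hn

/-- Two steps of the Schur algorithm, followed by the bound of the value at the origin in the third,
parametrize the first three coefficients of a Schwarz function. -/
theorem schwarz_coeff {w : ℂ → ℂ} {c₁ c₂ c₃ : ℂ} (hw : DifferentiableOn ℂ w unitDisk)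
    (h0 : w 0 = 0) (h1 : ∀ z ∈ unitDisk, ‖w z‖ < 1) (hj : HasCubicJet w 0 c₁ c₂ c₃) :
    ‖c₁‖ ≤ 1 ∧ ∃ x p : ℂ, ‖x‖ ≤ 1 ∧ ‖p‖ ≤ 1 - ‖x‖ ^ 2 ∧ c₂ = (1 - (‖c₁‖ : ℂ) ^ 2) * x ∧
      c₃ = (1 - (‖c₁‖ : ℂ) ^ 2) * (p - (starRingEnd ℂ) c₁ * x ^ 2) := by
  obtain ⟨φ, hφ, hφ1, hφz⟩ := exists_eq_mul_of_norm_le_one hw h0 fun z hz => (h1 z hz).le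
  have hφj := hφ.analyticAt_zero.hasCubicJet
  obtain ⟨-, e1, e2, e3⟩ := hj.unique
    ((HasCubicJet.id.mul hφj).congr (.of_forall fun z => (hφz z).symm))
  simp only [zero_mul, one_mul, zero_add, add_zero] at e1 e2 e3
  rw [← e1, ← e2, ← e3] at hφj
  obtain ⟨hc, χ, p₀, p₁, p₂, p₃, hχ, hχ1, hχj, f1, f2⟩ := schur_step_jet hφ hφ1 hφj
  obtain ⟨hp, η, q₀, q₁, q₂, q₃, hη, hη1, hηj, g1, -⟩ := schur_step_jet hχ hχ1 hχj
  have hq := (schur_step_jet hη hη1 hηj).1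
  refine ⟨hc, p₀, p₁, hp, ?_, f1, ?_⟩
  · have hnn : 0 ≤ 1 - ‖p₀‖ ^ 2 := by nlinarith [norm_nonneg p₀]
    have : (1 - (‖p₀‖ : ℂ) ^ 2) = ((1 - ‖p₀‖ ^ 2 : ℝ) : ℂ) := by push_cast; rfl
    rw [g1, this, norm_mul, Complex.norm_real, Real.norm_of_nonneg hnn]
    exact mul_le_of_le_one_right hnn hq
  · rw [f2, f1]; ring

/-! ### The Hankel determinant through Schur parameters -/

/-- If `F ≺ H(·, t)`, then the Schwarz function `w` satisfies `F (1 - 2 t w + w²) = 1` near the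
origin, so that no division by the denominator of `H` is needed. -/
theorem Subordinate.exists_schwarz {F : ℂ → ℂ} {t : ℝ} (h : Subordinate F (chebyshevH t)) :
    ∃ (w : ℂ → ℂ) (c₁ c₂ c₃ : ℂ), HasCubicJet w 0 c₁ c₂ c₃ ∧
      (∀ᶠ z in 𝓝 0, F z * (1 - 2 * (t : ℂ) * w z + w z * w z) = 1) ∧
      ‖c₁‖ ≤ 1 ∧ ∃ x p : ℂ, ‖x‖ ≤ 1 ∧ ‖p‖ ≤ 1 - ‖x‖ ^ 2 ∧ c₂ = (1 - (‖c₁‖ : ℂ) ^ 2) * x ∧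
        c₃ = (1 - (‖c₁‖ : ℂ) ^ 2) * (p - (starRingEnd ℂ) c₁ * x ^ 2) := by
  obtain ⟨w, hw, w0, hw1, hF⟩ := h
  have hj := hw.analyticAt_zero.hasCubicJet
  have hj0 : taylorCoeff w 0 = 0 := by simp [taylorCoeff, w0]
  rw [hj0] at hj
  refine ⟨w, _, _, _, hj, ?_, schwarz_coeff hw w0 hw1 hj⟩
  have hcont : ContinuousAt (fun z => 1 - 2 * (t : ℂ) * w z + w z ^ 2) 0 := by
    have := hw.analyticAt_zero.continuousAt
    fun_prop
  have hne : ∀ᶠ z in 𝓝 0, 1 - 2 * (t : ℂ) * w z + w z ^ 2 ≠ 0 :=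
    hcont.eventually_ne (by simp [w0])
  filter_upwards [hne, unitDisk_mem_nhds_zero] with z hz hzd
  rw [hF z hzd, chebyshevH, ← sq, one_div, inv_mul_cancel₀ hz]

/-- The derivative of the inverse function, transported to the `z`-plane. -/
theorem IsInverseOnDisk.deriv_mul_deriv {f g : ℂ → ℂ} (hf : f ∈ classA)
    (h : IsInverseOnDisk f g) : ∀ᶠ z in 𝓝 0, deriv g (f z) * deriv f z = 1 := by
  obtain ⟨hfd, f0, -⟩ := hf
  obtain ⟨hgd, hgf⟩ := h
  have hft : Tendsto f (𝓝 0) (𝓝 0) := by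
    simpa [f0] using hfd.analyticAt_zero.continuousAt.tendsto
  filter_upwards [hgf.eventually_nhds, unitDisk_mem_nhds_zero,
    hft.eventually unitDisk_mem_nhds_zero] with z hz hzd hfz
  have hd1 := (hfd.differentiableAt (Metric.isOpen_ball.mem_nhds hzd)).hasDerivAt
  have hd2 := (hgd.differentiableAt (Metric.isOpen_ball.mem_nhds hfz)).hasDerivAt
  have hd3 : HasDerivAt (g ∘ f) 1 z :=
    (hasDerivAt_id z).congr_of_eventuallyEq (hz.mono fun _ h => h)
  exact (hd2.comp z hd1).unique hd3

/-- Comparing coefficients in `f' (1 - 2 t w + w²) = 1` and in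
`f' = 1 - 2 t v(f) + v(f)²` expresses `a₂ a₄ - a₃²` through the coefficients of the two
Schwarz functions `w` and `v`. -/
theorem hankel_eq {t : ℝ} (ht : t ≠ 0) {f w v : ℂ → ℂ} {c₁ c₂ c₃ d₁ d₂ d₃ : ℂ} (hf : f ∈ classA)
    (hw : HasCubicJet w 0 c₁ c₂ c₃) (hv : HasCubicJet v 0 d₁ d₂ d₃)
    (hfw : ∀ᶠ z in 𝓝 0, deriv f z * (1 - 2 * (t : ℂ) * w z + w z * w z) = 1)
    (hfv : ∀ᶠ z in 𝓝 0, deriv f z = 1 - 2 * (t : ℂ) * v (f z) + v (f z) * v (f z)) :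
    d₁ = -c₁ ∧ taylorCoeff f 2 * taylorCoeff f 4 - taylorCoeff f 3 ^ 2 =
      t ^ 3 / 6 * c₁ ^ 2 * (c₂ - d₂) + t ^ 2 / 4 * c₁ * (c₃ - d₃)
        + t * (4 * t ^ 2 - 1) / 4 * c₁ ^ 2 * (c₂ + d₂) - t ^ 2 * (1 - t ^ 2) * c₁ ^ 4
        - t ^ 2 / 9 * (c₂ - d₂) ^ 2 := by
  obtain ⟨hfd, f0, f1⟩ := hf
  have hfj := hfd.analyticAt_zero.hasCubicJet
  have hdj := (hfd.analyticAt_zero.deriv).hasCubicJet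
  have hc0 : taylorCoeff f 0 = 0 := by simp [taylorCoeff, f0]
  have hc1 : taylorCoeff f 1 = 1 := by simp [taylorCoeff, f1]
  simp only [taylorCoeff_deriv, hc0, hc1, zero_add] at hfj hdj
  set a₂ := taylorCoeff f 2
  set a₃ := taylorCoeff f 3
  set a₄ := taylorCoeff f 4
  obtain ⟨-, e1, e2, e3⟩ := ((hdj.mul (((HasCubicJet.const 1).sub
    (hw.const_mul (2 * (t : ℂ)))).add (hw.mul hw))).congr hfw).unique (HasCubicJet.const 1)
  have hvf := hv.comp hfj
  obtain ⟨-, k1, k2, k3⟩ := (hdj.congr hfv).unique (((HasCubicJet.const 1).sub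
    (hvf.const_mul (2 * (t : ℂ)))).add (hvf.mul hvf))
  norm_num at e1 e2 e3 k1 k2 k3
  have ht' : (t : ℂ) ≠ 0 := by exact_mod_cast ht
  have ha₂ : a₂ = t * c₁ := by linear_combination e1 / 2
  have hd₁ : d₁ = -c₁ := by
    apply mul_left_cancel₀ ht'
    linear_combination -ha₂ + k1 / 2
  subst hd₁
  rw [ha₂] at e2 e3 k2 k3 ⊢
  refine ⟨rfl, ?_⟩
  have ha₃ : a₃ = t ^ 2 * c₁ ^ 2 + t / 3 * (c₂ - d₂) := by linear_combination (e2 + k2) / 6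
  rw [ha₃] at e2 e3 k2 k3 ⊢
  -- Here `e2` reads `t (c₂ + d₂) = (1 - t²) c₁²`; it is used to bring the factor `4 t² - 1` into
  -- the `c₂ + d₂` term.
  linear_combination t * c₁ / 8 * (e3 + k3) + t ^ 2 * c₁ ^ 2 * e2

/-- The majorant obtained from the triangle inequality is largest when both Schur parameters have
modulus one. -/
theorem hankel_majorant_le {t r X Y : ℝ} (ht : 1 / 2 < t) (hr : 0 ≤ r) (hr1 : r ≤ 1)
    (hX : 0 ≤ X) (hX1 : X ≤ 1) (hY : 0 ≤ Y) (hY1 : Y ≤ 1) :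
    t ^ 3 / 6 * (r ^ 2 * ((1 - r ^ 2) * (X + Y)))
        + t ^ 2 / 4 * (r * ((1 - r ^ 2) * (2 - (1 - r) * (X ^ 2 + Y ^ 2))))
        + t * (4 * t ^ 2 - 1) / 4 * (r ^ 2 * ((1 - r ^ 2) * (X + Y)))
        + t ^ 2 * (1 - t ^ 2) * r ^ 4
        + t ^ 2 / 9 * ((1 - r ^ 2) * (X + Y)) ^ 2 ≤
      t ^ 2 * (1 - t ^ 2) * (r ^ 2) ^ 2
        + (7 / 3 * t ^ 3 + t ^ 2 / 2 - t / 2) * r ^ 2 * (1 - r ^ 2)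
        + 4 * t ^ 2 / 9 * (1 - r ^ 2) ^ 2 := by
  have ht0 : 0 < t := by linarith
  have hU : 0 < 4 * t ^ 2 - 1 := by nlinarith
  have hk : 0 ≤ 1 - r ^ 2 := by nlinarith
  -- The defect is a sum of two nonnegative terms: the first comes from the part linear in `X + Y`,
  -- the second from the quadratic part, using `2 (X² + Y²) ≥ (X + Y)²`.
  have hs : 0 ≤ 2 - (X + Y) := by linarith
  have hs2 : 0 ≤ 4 - (X + Y) ^ 2 := by nlinarith
  have hl : 0 ≤ r ^ 2 * (1 - r ^ 2) * (t ^ 3 / 6 + t * (4 * t ^ 2 - 1) / 4) * (2 - (X + Y)) := by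
    positivity
  have hr2 : 0 ≤ 1 - r := by linarith
  have h8 : 0 ≤ 8 - r := by linarith
  have hquad : 0 ≤ t ^ 2 * (1 - r ^ 2) * (1 - r) *
      ((4 - (X + Y) ^ 2) * (8 - r) / 72 + r / 8 * (X - Y) ^ 2) := by
    positivity
  linear_combination hl + hquad

/-- The triangle inequality applied to the expression in `hankel_eq`, with `d₁ = -c₁` and the
remaining coefficients written through the Schur parameters `x, p` and `y, q`. -/
theorem norm_hankel_le {t : ℝ} (ht : 1 / 2 < t) (ht1 : t < 1) {c x p y q : ℂ}
    (hc : ‖c‖ ≤ 1) (hx : ‖x‖ ≤ 1) (hp : ‖p‖ ≤ 1 - ‖x‖ ^ 2) (hy : ‖y‖ ≤ 1)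
    (hq : ‖q‖ ≤ 1 - ‖y‖ ^ 2) {c₂ c₃ d₂ d₃ : ℂ}
    (h2 : c₂ = (1 - (‖c‖ : ℂ) ^ 2) * x)
    (h3 : c₃ = (1 - (‖c‖ : ℂ) ^ 2) * (p - (starRingEnd ℂ) c * x ^ 2))
    (k2 : d₂ = (1 - (‖c‖ : ℂ) ^ 2) * y)
    (k3 : d₃ = (1 - (‖c‖ : ℂ) ^ 2) * (q + (starRingEnd ℂ) c * y ^ 2)) :
    ‖(t : ℂ) ^ 3 / 6 * c ^ 2 * (c₂ - d₂) + t ^ 2 / 4 * c * (c₃ - d₃)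
        + t * (4 * t ^ 2 - 1) / 4 * c ^ 2 * (c₂ + d₂) - t ^ 2 * (1 - t ^ 2) * c ^ 4
        - t ^ 2 / 9 * (c₂ - d₂) ^ 2‖ ≤
      t ^ 2 * (1 - t ^ 2) * (‖c‖ ^ 2) ^ 2
        + (7 / 3 * t ^ 3 + t ^ 2 / 2 - t / 2) * ‖c‖ ^ 2 * (1 - ‖c‖ ^ 2)
        + 4 * t ^ 2 / 9 * (1 - ‖c‖ ^ 2) ^ 2 := by
  have hr := norm_nonneg c
  have hX := norm_nonneg x
  have hY := norm_nonneg y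
  have hk : 0 ≤ 1 - ‖c‖ ^ 2 := by nlinarith
  have hkn : ‖1 - (‖c‖ : ℂ) ^ 2‖ = 1 - ‖c‖ ^ 2 := by
    rw [← Complex.ofReal_pow, ← Complex.ofReal_one, ← Complex.ofReal_sub, Complex.norm_real,
      Real.norm_of_nonneg hk]
  have n2 : ‖c₂‖ = (1 - ‖c‖ ^ 2) * ‖x‖ := by rw [h2, norm_mul, hkn]
  have m2 : ‖d₂‖ = (1 - ‖c‖ ^ 2) * ‖y‖ := by rw [k2, norm_mul, hkn]
  have n3 : ‖c₃‖ ≤ (1 - ‖c‖ ^ 2) * (1 - ‖x‖ ^ 2 + ‖c‖ * ‖x‖ ^ 2) := by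
    rw [h3, norm_mul, hkn]
    gcongr
    refine (norm_sub_le _ _).trans ?_
    rw [norm_mul, RCLike.norm_conj, norm_pow]
    gcongr
  have m3 : ‖d₃‖ ≤ (1 - ‖c‖ ^ 2) * (1 - ‖y‖ ^ 2 + ‖c‖ * ‖y‖ ^ 2) := by
    rw [k3, norm_mul, hkn]
    gcongr
    refine (norm_add_le _ _).trans ?_
    rw [norm_mul, RCLike.norm_conj, norm_pow]
    gcongr
  generalize ‖x‖ = X at *
  generalize ‖y‖ = Y at *
  have nD : ‖c₂ - d₂‖ ≤ (1 - ‖c‖ ^ 2) * (X + Y) :=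
    (norm_sub_le _ _).trans_eq (by rw [n2, m2]; ring)
  have nS : ‖c₂ + d₂‖ ≤ (1 - ‖c‖ ^ 2) * (X + Y) :=
    (norm_add_le _ _).trans_eq (by rw [n2, m2]; ring)
  have nT : ‖c₃ - d₃‖ ≤ (1 - ‖c‖ ^ 2) * (2 - (1 - ‖c‖) * (X ^ 2 + Y ^ 2)) :=
    (norm_sub_le _ _).trans ((add_le_add n3 m3).trans_eq (by ring))
  have ht0 : 0 < t := by linarith
  have hU : 0 < 4 * t ^ 2 - 1 := by nlinarith
  have hV : 0 < 1 - t ^ 2 := by nlinarith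
  have cast : ∀ {s : ℝ} (z : ℂ), 0 ≤ s → ‖(s : ℂ) * z‖ = s * ‖z‖ := fun z hs => by
    rw [norm_mul, Complex.norm_real, Real.norm_of_nonneg hs]
  -- The five summands, with real coefficients made explicit.
  have e : (t : ℂ) ^ 3 / 6 * c ^ 2 * (c₂ - d₂) + t ^ 2 / 4 * c * (c₃ - d₃)
        + t * (4 * t ^ 2 - 1) / 4 * c ^ 2 * (c₂ + d₂) - t ^ 2 * (1 - t ^ 2) * c ^ 4
        - t ^ 2 / 9 * (c₂ - d₂) ^ 2
      = ((t ^ 3 / 6 : ℝ) : ℂ) * (c ^ 2 * (c₂ - d₂)) + ((t ^ 2 / 4 : ℝ) : ℂ) * (c * (c₃ - d₃))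
        + ((t * (4 * t ^ 2 - 1) / 4 : ℝ) : ℂ) * (c ^ 2 * (c₂ + d₂))
        - ((t ^ 2 * (1 - t ^ 2) : ℝ) : ℂ) * c ^ 4 - ((t ^ 2 / 9 : ℝ) : ℂ) * (c₂ - d₂) ^ 2 := by
    push_cast
    ring
  have b : ‖(t : ℂ) ^ 3 / 6 * c ^ 2 * (c₂ - d₂) + t ^ 2 / 4 * c * (c₃ - d₃)
        + t * (4 * t ^ 2 - 1) / 4 * c ^ 2 * (c₂ + d₂) - t ^ 2 * (1 - t ^ 2) * c ^ 4
        - t ^ 2 / 9 * (c₂ - d₂) ^ 2‖ ≤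
      t ^ 3 / 6 * (‖c‖ ^ 2 * ((1 - ‖c‖ ^ 2) * (X + Y)))
        + t ^ 2 / 4 * (‖c‖ * ((1 - ‖c‖ ^ 2) * (2 - (1 - ‖c‖) * (X ^ 2 + Y ^ 2))))
        + t * (4 * t ^ 2 - 1) / 4 * (‖c‖ ^ 2 * ((1 - ‖c‖ ^ 2) * (X + Y)))
        + t ^ 2 * (1 - t ^ 2) * ‖c‖ ^ 4
        + t ^ 2 / 9 * ((1 - ‖c‖ ^ 2) * (X + Y)) ^ 2 := by
    rw [e]
    refine (norm_sub_le _ _).trans (add_le_add ((norm_sub_le _ _).trans (add_le_add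
      ((norm_add_le _ _).trans (add_le_add ((norm_add_le _ _).trans (add_le_add ?_ ?_)) ?_)) ?_)) ?_)
    all_goals
      rw [cast _ (by positivity)]
      simp only [norm_mul, norm_pow]
      gcongr
  exact b.trans (hankel_majorant_le ht hr hc hX hx hY hy)

/-- The Hankel determinant is dominated by a quadratic polynomial in `u = |c₁|² ∈ [0, 1]`. -/
theorem exists_norm_hankel_le {t : ℝ} (ht : 1 / 2 < t) (ht1 : t < 1) {f : ℂ → ℂ}
    (hf : f ∈ classBSigma t) :
    ∃ u : ℝ, 0 ≤ u ∧ u ≤ 1 ∧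
      ‖taylorCoeff f 2 * taylorCoeff f 4 - taylorCoeff f 3 ^ 2‖ ≤
        t ^ 2 * (1 - t ^ 2) * u ^ 2 + (7 / 3 * t ^ 3 + t ^ 2 / 2 - t / 2) * u * (1 - u)
          + 4 * t ^ 2 / 9 * (1 - u) ^ 2 := by
  obtain ⟨⟨⟨hfA, -⟩, -⟩, hsf, g, hg, hsg⟩ := hf
  obtain ⟨w, c₁, c₂, c₃, hw, hfw, hc, x, p, hx, hp, h2, h3⟩ := hsf.exists_schwarz
  obtain ⟨v, d₁, d₂, d₃, hv, hgv, -, y, q, hy, hq, k2, k3⟩ := hsg.exists_schwarz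
  have hft : Tendsto f (𝓝 0) (𝓝 0) := by
    simpa [hfA.2.1] using hfA.1.analyticAt_zero.continuousAt.tendsto
  have hfv : ∀ᶠ z in 𝓝 0, deriv f z = 1 - 2 * (t : ℂ) * v (f z) + v (f z) * v (f z) := by
    filter_upwards [hft.eventually hgv, hg.deriv_mul_deriv hfA] with z h1 h2
    have hne : deriv g (f z) ≠ 0 := left_ne_zero_of_mul_eq_one h2
    exact mul_left_cancel₀ hne (h2.trans h1.symm)
  obtain ⟨rfl, hH⟩ := hankel_eq (by linarith) hfA hw hv hfw hfv
  rw [norm_neg] at k2 k3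
  refine ⟨‖c₁‖ ^ 2, by positivity, pow_le_one₀ (norm_nonneg _) hc, ?_⟩
  rw [hH]
  refine norm_hankel_le ht ht1 hc hx hp hy hq h2 h3 k2 ?_
  rw [k3, map_neg]
  ring

/-! ### The threshold and the bounds -/

/-- On `(0, 1)` the threshold quantity is a negative multiple of a cubic. -/
theorem M₁_one_one {t : ℝ} (h0 : 0 < t) (h1 : t < 1) :
    M₁ 1 1 t = -(192 * t) * (18 * t ^ 3 + 42 * t ^ 2 - 17 * t - 9) := by
  have hneg : 3 * (2 * t ^ 2 - 1) * ((1 : ℝ) + 1) ^ 3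
      - (1 ^ 2 + 3 * 1 + 2) * (3 * 1 + 1) * t ^ 2 ≤ 0 := by
    nlinarith
  rw [M₁, abs_of_nonpos hneg]
  ring

theorem cubic_lt {s t : ℝ} (hs : 1 / 2 < s) (hst : s < t) :
    18 * s ^ 3 + 42 * s ^ 2 - 17 * s - 9 < 18 * t ^ 3 + 42 * t ^ 2 - 17 * t - 9 := by
  have h : 0 < (t - s) * (18 * (t ^ 2 + t * s + s ^ 2) + 42 * (t + s) - 17) :=
    mul_pos (by linarith) (by nlinarith)
  linear_combination h

theorem mainTheorem2 :
    ∃ t₀ : ℝ, (1 / 2 < t₀ ∧ t₀ < 1 ∧ M₁ 1 1 t₀ = 0) ∧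
      (∀ s : ℝ, 1 / 2 < s → s < 1 → M₁ 1 1 s = 0 → s = t₀) ∧
      |t₀ - 0.603615| < 10 ^ (-6 : ℤ) ∧
      ∀ (t : ℝ) (f : ℂ → ℂ), f ∈ classBSigma t →
        (1 / 2 < t → t ≤ t₀ →
          ‖taylorCoeff f 2 * taylorCoeff f 4 - taylorCoeff f 3 ^ 2‖ ≤ t ^ 2 * (1 - t ^ 2)) ∧
        (t₀ < t → t < 1 →
          ‖taylorCoeff f 2 * taylorCoeff f 4 - taylorCoeff f 3 ^ 2‖ ≤
            t * (260 * t ^ 4 + 84 * t ^ 3 - 139 * t ^ 2 - 18 * t + 9) /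
              (8 * (18 * t ^ 3 + 42 * t ^ 2 - 17 * t - 9))) := by
  have hcont : Continuous fun t : ℝ => 18 * t ^ 3 + 42 * t ^ 2 - 17 * t - 9 := by fun_prop
  obtain ⟨t₀, ⟨hlo, hhi⟩, hroot⟩ := intermediate_value_Ioo
    (by norm_num : (0.603614 : ℝ) ≤ 0.603616) hcont.continuousOn
    (show (0 : ℝ) ∈ _ by constructor <;> norm_num)
  simp only at hroot
  have hh : 1 / 2 < t₀ := lt_trans (by norm_num) hlo
  have hh1 : t₀ < 1 := lt_trans hhi (by norm_num)
  refine ⟨t₀, ⟨hh, hh1, ?_⟩, fun s hs hs1 hM => ?_, ?_, fun t f hf => ⟨fun ht htt => ?_,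
    fun htt ht1 => ?_⟩⟩
  · rw [M₁_one_one (by linarith) hh1, hroot, mul_zero]
  · rw [M₁_one_one (by linarith) hs1] at hM
    have hs0 := (mul_eq_zero.1 hM).resolve_left (by linarith)
    rcases lt_trichotomy s t₀ with h | h | h
    · linarith [cubic_lt hs h]
    · exact h
    · linarith [cubic_lt hh h]
  · rw [abs_lt]
    norm_num at hlo hhi ⊢
    constructor <;> linarith
  · obtain ⟨u, hu, hu1, h⟩ := exists_norm_hankel_le ht (htt.trans_lt hh1) hf
    refine h.trans ?_
    have hP : 18 * t ^ 3 + 42 * t ^ 2 - 17 * t - 9 ≤ 0 := by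
      rcases htt.eq_or_lt with rfl | h
      · exact hroot.le
      · linarith [cubic_lt ht h]
    have ht0 : 0 < t := by linarith
    have ht2 : 0 ≤ 5 - 9 * t ^ 2 := by nlinarith [htt.trans hhi.le]
    have hu2 : 0 ≤ 1 - u := by linarith
    -- The quadratic in `u` is convex, so it is at most its chord, and the chord is maximal at
    -- `u = 1` because `4 / 9 ≤ 1 - t²`.
    have h1 : 0 ≤ t / 18 * (-(18 * t ^ 3 + 42 * t ^ 2 - 17 * t - 9)) * (u * (1 - u)) :=
      mul_nonneg (mul_nonneg (by linarith) (by linarith)) (mul_nonneg hu hu2)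
    have h2 : 0 ≤ t ^ 2 / 9 * (5 - 9 * t ^ 2) * (1 - u) := by positivity
    linear_combination h1 + h2
  · have ht : 1 / 2 < t := hh.trans htt
    obtain ⟨u, hu, hu1, h⟩ := exists_norm_hankel_le ht ht1 hf
    refine h.trans ?_
    have hP : 0 < 18 * t ^ 3 + 42 * t ^ 2 - 17 * t - 9 := by linarith [cubic_lt hh htt]
    have ht0 : 0 < t := by linarith
    -- The quadratic in `u` is concave; the bound is its value at the vertex.
    rw [le_div_iff₀ (by positivity)]
    have h1 : 0 ≤ t / 9 * (2 * (18 * t ^ 3 + 42 * t ^ 2 - 17 * t - 9) * u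
        - (42 * t ^ 2 - 7 * t - 9)) ^ 2 := by positivity
    linear_combination h1
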